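/- Let $\mathcal{L}$ be a first-order language without equality, with variables $v_0,v_1,\dots$, connectives $\top,\bot,\land,\lor,\to,\neg,\forall,\exists$, function symbols (nullary ones are the constants) and predicate symbols, among them a distinguished unary "existence" predicate $E$. Here $\neg$ is a primitive connective; write ${\rightharpoondown}A$ for $A\to\bot$. The *global negative* formulas are $N::=\bot\mid\neg A\mid N\land N\mid N\lor N\mid N\to N\mid\forall xN\mid\exists xN$ with $A$ an arbitrary formula. A variable $x$ *occurs only globally* in $A$ if it occurs free in $A$ and every free occurrence of it lies in a global negative subformula of $A$; a quantification $QxA$ is *global* in this case and *local* otherwise (in particular if it is vacuous). The class $\mathrm{ST}$ is $S::=\top\mid N\mid S\land S\mid S\lor N\mid N\lor S\mid A\to B\mid\forall xA$ with $N$ global negative and $A,B$ arbitrary; the class $\mathrm{ST_P}$ is $S'::=S\mid S'\lor S'\mid\exists xS'$ with $S\in\mathrm{ST}$ and $\exists xS'$ global. $\mathbf{NSF_P}$ is the natural deduction system with the usual introduction and elimination rules for $\land$ and $\lor$, the axiom $\top$, the rule $\bot/A$, and the following rules: - strictness: $P(t_1,\dots,t_n)/E(t_i)$ and $E(f(t_1,\dots,t_n))/E(t_i)$;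 - $({\to}\mathrm I)$: from a derivation of ${\rightharpoondown}{\rightharpoondown}B$ from $A$ infer $A\to B$, discharging $A$; $({\to}\mathrm E)$: from $A\to B$ and $A$ infer ${\rightharpoondown}{\rightharpoondown}B$; - from ${\rightharpoondown}A$ infer $\neg A$; from $\neg A$ and $A$ infer $\bot$; from ${\rightharpoondown}{\rightharpoondown}S$ infer $S$ if $S\in\mathrm{ST_P}$; - axioms $\neg\neg A\to A$ and $\forall x\neg\neg E(x)$; - $(\forall\mathrm I)$: from ${\rightharpoondown}{\rightharpoondown}A$ infer $\forall xA$ if $x$ is not free in the open hypotheses; $(\forall\mathrm E)$: from $\forall xA$ infer ${\rightharpoondown}{\rightharpoondown}A[t/x]$, $t$ free for $x$ in $A$; - $(\exists\mathrm I)$: from $A[t/x]$, $t$ free for $x$ in $A$, and, if $\exists xA$ is local, also $E(t)$, infer $\exists xA$; - $(\exists\mathrm E)$: from $\exists yA$ and a derivation of $C$ from $A[x/y]$, and, if $\exists yA$ is local, also $E(x)$, infer $C$, discharging these hypotheses, where $x$ is free for $y$ in $A$ and not free in $\exists yA$, in $C$ or in the other open hypotheses of the derivation of $C$. Let $\mathbf{CQC}$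 be the set of the closed formulas without $\neg$ and $E$ that are theorems of classical first-order logic (negation being ${\rightharpoondown}$), and let $\mathbf{SFQ_P^{-\neg E}}$ be the set of the closed theorems of $\mathbf{NSF_P}$ in which neither $\neg$ nor $E$ occurs. Then: (i) for every formula $A$, $A\in\mathbf{CQC}$ if and only if ${\rightharpoondown}{\rightharpoondown}A\in\mathbf{SFQ_P^{-\neg E}}$; (ii) for every $E$-free formula $A\in\mathrm{ST_P}$, if $A\in\mathbf{CQC}$ then $A\in\mathbf{SFQ_P^{-\neg E}}$. -/

import Mathlib

universe u v

namespace SFQ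

/-- Formulas of the language of strict finitistic first-order logic.  The signature `L` supplies
the function symbols (constants are the nullary ones) and the predicate symbols other than the
distinguished unary existence predicate `E`, whose atoms are the formulas `exi t`.  The variables
are `v_0, v_1, ...`, indexed by `ℕ`.  The strict finitistic negation `neg` is primitive. -/
inductive Fm (L : FirstOrder.Language.{u, v}) : Type (max u v)
  | top : Fm L
  | bot : Fm L
  | atom {n : ℕ} (P : L.Relations n) (ts : Fin n → L.Term ℕ) : Fm L
  | exi (t : L.Term ℕ) : Fm L
  | and (A B : Fm L) : Fm L
  | or (A B : Fm L) : Fm L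
  | imp (A B : Fm L) : Fm L
  | neg (A : Fm L) : Fm L
  | all (x : ℕ) (A : Fm L) : Fm L
  | ex (x : ℕ) (A : Fm L) : Fm L

namespace Fm

variable {L : FirstOrder.Language.{u, v}}

/-- The weak negation `A → ⊥`. -/
def wneg (A : Fm L) : Fm L := A.imp bot

/-- The free variables of a formula. -/
def freeVars : Fm L → Finset ℕ
  | top => ∅
  | bot => ∅
  | atom _ ts => Finset.univ.biUnion fun i => (ts i).varFinset
  | exi t => t.varFinset
  | and A B => A.freeVars ∪ B.freeVars
  | or A B => A.freeVars ∪ B.freeVars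
  | imp A B => A.freeVars ∪ B.freeVars
  | neg A => A.freeVars
  | all x A => A.freeVars.erase x
  | ex x A => A.freeVars.erase x

/-- Closed formulas. -/
def Closed (A : Fm L) : Prop := A.freeVars = ∅

/-- Substitution `s[t/x]` of a term for a variable in a term. -/
def substTerm (x : ℕ) (t s : L.Term ℕ) : L.Term ℕ :=
  s.subst fun y => if y = x then t else FirstOrder.Language.Term.var y

/-- Substitution `A[t/x]` of the term `t` for the free occurrences of the variable `x` in `A`;
it is used only if `t` is free for `x` in `A`. -/
def subst (x : ℕ) (t : L.Term ℕ) : Fm L → Fm L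
  | top => top
  | bot => bot
  | atom P ts => atom P fun i => substTerm x t (ts i)
  | exi s => exi (substTerm x t s)
  | and A B => and (A.subst x t) (B.subst x t)
  | or A B => or (A.subst x t) (B.subst x t)
  | imp A B => imp (A.subst x t) (B.subst x t)
  | neg A => neg (A.subst x t)
  | all y A => if y = x then all y A else all y (A.subst x t)
  | ex y A => if y = x then ex y A else ex y (A.subst x t)

/-- The term `t` is free for `x` in `A`: no free occurrence of `x` in `A` lies in the scope of a
quantifier that binds a variable of `t`. -/
def FreeFor (t : L.Term ℕ) (x : ℕ) : Fm L → Prop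
  | top => True
  | bot => True
  | atom _ _ => True
  | exi _ => True
  | and A B => A.FreeFor t x ∧ B.FreeFor t x
  | or A B => A.FreeFor t x ∧ B.FreeFor t x
  | imp A B => A.FreeFor t x ∧ B.FreeFor t x
  | neg A => A.FreeFor t x
  | all y A => x ∉ (all y A).freeVars ∨ (y ∉ t.varFinset ∧ A.FreeFor t x)
  | ex y A => x ∉ (ex y A).freeVars ∨ (y ∉ t.varFinset ∧ A.FreeFor t x)

/-- The global negative formulas: `N ::= ⊥ | ¬A | N ∧ N | N ∨ N | N → N | ∀x N | ∃x N`,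
where `A` is an arbitrary formula. -/
def GN : Fm L → Prop
  | top => False
  | bot => True
  | atom _ _ => False
  | exi _ => False
  | and A B => A.GN ∧ B.GN
  | or A B => A.GN ∧ B.GN
  | imp A B => A.GN ∧ B.GN
  | neg _ => True
  | all _ A => A.GN
  | ex _ A => A.GN

/-- `x` has a free occurrence in the formula that lies in none of its global negative
subformulas (the formula itself being one of its subformulas). -/
def OccursNonGlobally (x : ℕ) : Fm L → Prop
  | top => False
  | bot => False
  | atom P ts => x ∈ (atom P ts).freeVars
  | exi t => x ∈ t.varFinset
  | and A B => ¬ (and A B).GN ∧ (A.OccursNonGlobally x ∨ B.OccursNonGlobally x)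
  | or A B => ¬ (or A B).GN ∧ (A.OccursNonGlobally x ∨ B.OccursNonGlobally x)
  | imp A B => ¬ (imp A B).GN ∧ (A.OccursNonGlobally x ∨ B.OccursNonGlobally x)
  | neg _ => False
  | all y A => ¬ (all y A).GN ∧ x ≠ y ∧ A.OccursNonGlobally x
  | ex y A => ¬ (ex y A).GN ∧ x ≠ y ∧ A.OccursNonGlobally x

/-- `x` occurs only globally in `A`: it occurs free in `A`, and each of its free occurrences lies
in a global negative subformula of `A`.  In particular, a vacuous quantification is local. -/
def OccursOnlyGlobally (x : ℕ) (A : Fm L) : Prop :=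
  x ∈ A.freeVars ∧ ¬ A.OccursNonGlobally x

/-- The class `ST`: `S ::= ⊤ | N | S ∧ S | S ∨ N | N ∨ S | A → B | ∀x A`, where `N` is global
negative and `A`, `B` are arbitrary formulas. -/
inductive ST : Fm L → Prop
  | top : ST top
  | gn {N : Fm L} : N.GN → ST N
  | and {S T : Fm L} : ST S → ST T → ST (S.and T)
  | orLeft {S N : Fm L} : ST S → N.GN → ST (S.or N)
  | orRight {N S : Fm L} : N.GN → ST S → ST (N.or S)
  | imp (A B : Fm L) : ST (A.imp B)
  | all (x : ℕ) (A : Fm L) : ST (A.all x)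

/-- The stable class `ST_P`: `S' ::= S | S' ∨ S' | ∃x S'`, where `S` is in `ST` and the
quantification `∃x S'` is global. -/
inductive STP : Fm L → Prop
  | st {S : Fm L} : ST S → STP S
  | or {S T : Fm L} : STP S → STP T → STP (S.or T)
  | ex {x : ℕ} {S : Fm L} : OccursOnlyGlobally x S → STP S → STP (S.ex x)

/-- Formulas in which the primitive negation does not occur. -/
def NegFree : Fm L → Prop
  | top => True
  | bot => True
  | atom _ _ => True
  | exi _ => True
  | and A B => A.NegFree ∧ B.NegFree
  | or A B => A.NegFree ∧ B.NegFree
  | imp A B => A.NegFree ∧ B.NegFree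
  | neg _ => False
  | all _ A => A.NegFree
  | ex _ A => A.NegFree

/-- Formulas in which the existence predicate does not occur. -/
def EFree : Fm L → Prop
  | top => True
  | bot => True
  | atom _ _ => True
  | exi _ => False
  | and A B => A.EFree ∧ B.EFree
  | or A B => A.EFree ∧ B.EFree
  | imp A B => A.EFree ∧ B.EFree
  | neg A => A.EFree
  | all _ A => A.EFree
  | ex _ A => A.EFree

/-- Formulas of the fragment without the primitive negation and the existence predicate. -/
def NegEFree (A : Fm L) : Prop := A.NegFree ∧ A.EFree

end Fm

open Fm

variable {L : FirstOrder.Language.{u, v}}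

/-- `x` does not occur free in any formula of `Γ`. -/
def NotFreeIn (x : ℕ) (Γ : Set (Fm L)) : Prop := ∀ B ∈ Γ, x ∉ B.freeVars

/-- Derivability in the natural deduction system of strict finitistic logic with prevalence:
`NSFP Γ A` says that there is a derivation of `A` all of whose open hypotheses are in `Γ`.
The constructor `weaken` lets `Γ` contain formulas on which the derivation does not depend. -/
inductive NSFP : Set (Fm L) → Fm L → Prop
  | hyp {Γ : Set (Fm L)} {A : Fm L} : A ∈ Γ → NSFP Γ A
  | weaken {Γ Δ : Set (Fm L)} {A : Fm L} : Γ ⊆ Δ → NSFP Γ A → NSFP Δ A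
  | topI {Γ : Set (Fm L)} : NSFP Γ top
  | botE {Γ : Set (Fm L)} {A : Fm L} : NSFP Γ bot → NSFP Γ A
  | andI {Γ : Set (Fm L)} {A B : Fm L} : NSFP Γ A → NSFP Γ B → NSFP Γ (A.and B)
  | andE₁ {Γ : Set (Fm L)} {A B : Fm L} : NSFP Γ (A.and B) → NSFP Γ A
  | andE₂ {Γ : Set (Fm L)} {A B : Fm L} : NSFP Γ (A.and B) → NSFP Γ B
  | orI₁ {Γ : Set (Fm L)} {A B : Fm L} : NSFP Γ A → NSFP Γ (A.or B)
  | orI₂ {Γ : Set (Fm L)} {A B : Fm L} : NSFP Γ B → NSFP Γ (A.or B)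
  | orE {Γ : Set (Fm L)} {A B C : Fm L} :
      NSFP Γ (A.or B) → NSFP (insert A Γ) C → NSFP (insert B Γ) C → NSFP Γ C
  | str₁ {Γ : Set (Fm L)} {n : ℕ} {P : L.Relations n} {ts : Fin n → L.Term ℕ} (i : Fin n) :
      NSFP Γ (atom P ts) → NSFP Γ (exi (ts i))
  | str₂ {Γ : Set (Fm L)} {n : ℕ} {f : L.Functions n} {ts : Fin n → L.Term ℕ} (i : Fin n) :
      NSFP Γ (exi (FirstOrder.Language.Term.func f ts)) → NSFP Γ (exi (ts i))
  | stP {Γ : Set (Fm L)} {S : Fm L} : STP S → NSFP Γ S.wneg.wneg → NSFP Γ S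
  | impI {Γ : Set (Fm L)} {A B : Fm L} : NSFP (insert A Γ) B.wneg.wneg → NSFP Γ (A.imp B)
  | impE {Γ : Set (Fm L)} {A B : Fm L} : NSFP Γ (A.imp B) → NSFP Γ A → NSFP Γ B.wneg.wneg
  | negI {Γ : Set (Fm L)} {A : Fm L} : NSFP Γ A.wneg → NSFP Γ A.neg
  | negE {Γ : Set (Fm L)} {A : Fm L} : NSFP Γ A.neg → NSFP Γ A → NSFP Γ bot
  | dne {Γ : Set (Fm L)} (A : Fm L) : NSFP Γ (A.neg.neg.imp A)
  | obj {Γ : Set (Fm L)} (x : ℕ) : NSFP Γ (all x (exi (FirstOrder.Language.Term.var x)).neg.neg)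
  | allI {Γ : Set (Fm L)} {x : ℕ} {A : Fm L} :
      NotFreeIn x Γ → NSFP Γ A.wneg.wneg → NSFP Γ (A.all x)
  | allE {Γ : Set (Fm L)} {x : ℕ} {A : Fm L} (t : L.Term ℕ) :
      A.FreeFor t x → NSFP Γ (A.all x) → NSFP Γ (A.subst x t).wneg.wneg
  | exGloI {Γ : Set (Fm L)} {x : ℕ} {A : Fm L} (t : L.Term ℕ) :
      OccursOnlyGlobally x A → A.FreeFor t x → NSFP Γ (A.subst x t) → NSFP Γ (A.ex x)
  | exLocI {Γ : Set (Fm L)} {x : ℕ} {A : Fm L} (t : L.Term ℕ) :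
      ¬ OccursOnlyGlobally x A → A.FreeFor t x → NSFP Γ (A.subst x t) → NSFP Γ (exi t) →
      NSFP Γ (A.ex x)
  | exGloE {Γ Δ : Set (Fm L)} {x y : ℕ} {A C : Fm L} :
      OccursOnlyGlobally y A →
      A.FreeFor (FirstOrder.Language.Term.var x) y → x ∉ (A.ex y).freeVars →
      x ∉ C.freeVars → NotFreeIn x Δ →
      NSFP Γ (A.ex y) →
      NSFP (insert (A.subst y (FirstOrder.Language.Term.var x)) Δ) C → NSFP (Γ ∪ Δ) C
  | exLocE {Γ Δ : Set (Fm L)} {x y : ℕ} {A C : Fm L} :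
      ¬ OccursOnlyGlobally y A →
      A.FreeFor (FirstOrder.Language.Term.var x) y → x ∉ (A.ex y).freeVars →
      x ∉ C.freeVars → NotFreeIn x Δ →
      NSFP Γ (A.ex y) →
      NSFP (insert (A.subst y (FirstOrder.Language.Term.var x))
        (insert (exi (FirstOrder.Language.Term.var x)) Δ)) C → NSFP (Γ ∪ Δ) C

/-- Derivability in the usual natural deduction system of classical first-order logic (without
equality) in the fragment without the primitive negation and the existence predicate; the negation
of the rule `raa` of reductio ad absurdum is `A → ⊥`.  The rules that bring in a new formula ask
it to be in the fragment, so that derivations from hypotheses in the fragment stay in it. -/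
inductive Classical : Set (Fm L) → Fm L → Prop
  | hyp {Γ : Set (Fm L)} {A : Fm L} : A ∈ Γ → Classical Γ A
  | weaken {Γ Δ : Set (Fm L)} {A : Fm L} : Γ ⊆ Δ → Classical Γ A → Classical Δ A
  | topI {Γ : Set (Fm L)} : Classical Γ top
  | botE {Γ : Set (Fm L)} {A : Fm L} : A.NegEFree → Classical Γ bot → Classical Γ A
  | raa {Γ : Set (Fm L)} {A : Fm L} :
      A.NegEFree → Classical (insert A.wneg Γ) bot → Classical Γ A
  | andI {Γ : Set (Fm L)} {A B : Fm L} :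
      Classical Γ A → Classical Γ B → Classical Γ (A.and B)
  | andE₁ {Γ : Set (Fm L)} {A B : Fm L} : Classical Γ (A.and B) → Classical Γ A
  | andE₂ {Γ : Set (Fm L)} {A B : Fm L} : Classical Γ (A.and B) → Classical Γ B
  | orI₁ {Γ : Set (Fm L)} {A B : Fm L} : B.NegEFree → Classical Γ A → Classical Γ (A.or B)
  | orI₂ {Γ : Set (Fm L)} {A B : Fm L} : A.NegEFree → Classical Γ B → Classical Γ (A.or B)
  | orE {Γ : Set (Fm L)} {A B C : Fm L} :
      Classical Γ (A.or B) → Classical (insert A Γ) C → Classical (insert B Γ) C →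
      Classical Γ C
  | impI {Γ : Set (Fm L)} {A B : Fm L} :
      A.NegEFree → Classical (insert A Γ) B → Classical Γ (A.imp B)
  | impE {Γ : Set (Fm L)} {A B : Fm L} :
      Classical Γ (A.imp B) → Classical Γ A → Classical Γ B
  | allI {Γ : Set (Fm L)} {x : ℕ} {A : Fm L} :
      NotFreeIn x Γ → Classical Γ A → Classical Γ (A.all x)
  | allE {Γ : Set (Fm L)} {x : ℕ} {A : Fm L} (t : L.Term ℕ) :
      A.FreeFor t x → Classical Γ (A.all x) → Classical Γ (A.subst x t)
  | exI {Γ : Set (Fm L)} {x : ℕ} {A : Fm L} (t : L.Term ℕ) :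
      A.FreeFor t x → Classical Γ (A.subst x t) → Classical Γ (A.ex x)
  | exE {Γ Δ : Set (Fm L)} {x y : ℕ} {A C : Fm L} :
      A.FreeFor (FirstOrder.Language.Term.var x) y → x ∉ (A.ex y).freeVars →
      x ∉ C.freeVars → NotFreeIn x Δ →
      Classical Γ (A.ex y) →
      Classical (insert (A.subst y (FirstOrder.Language.Term.var x)) Δ) C → Classical (Γ ∪ Δ) C

/-- The set of the classical first-order theorems: closed formulas without the primitive negation
and the existence predicate that have a classical derivation without open hypotheses. -/
def CQC (L : FirstOrder.Language.{u, v}) : Set (Fm L) :=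
  {A | A.Closed ∧ A.NegEFree ∧ Classical ∅ A}

/-- The set of the closed theorems of strict finitistic logic with prevalence in which neither the
primitive negation nor the existence predicate occurs (their derivations may use both). -/
def SFQPNegEFree (L : FirstOrder.Language.{u, v}) : Set (Fm L) :=
  {A | A.Closed ∧ A.NegEFree ∧ NSFP ∅ A}

end SFQ

namespace SFQ

open Fm

variable {L : FirstOrder.Language.{u, v}}

namespace NSFP

/-! In `NSFP`, double weak negation behaves like a monad, and the rules for `→` and `∀` already have
it built in. Hence each classical rule remains derivable with `⇀⇀` in front of its premises and
conclusion (`Classical.nsfp_wneg_wneg`). The extra `E(t)` of local existentials costs nothing there,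
since every `⇀⇀E(t)` is provable. Conversely, reading `E(t)` as `⊤` and `¬` as `⇀` turns every rule
of `NSFP` into a classically valid one (`NSFP.classical`), and this reading fixes formulas of the
fragment. Part (ii) then follows by one use of the stability rule `stP`. -/

/-- `⊥` is global negative, hence stable. As `impE` yields only `⇀⇀⊥`, this is what lets `⇀` obey
the usual negation rules. -/
theorem of_wneg_wneg_bot {Γ : Set (Fm L)} (h : NSFP Γ (bot : Fm L).wneg.wneg) : NSFP Γ bot :=
  stP (.st (.gn trivial)) h

theorem wnegI {Γ : Set (Fm L)} {A : Fm L} (h : NSFP (insert A Γ) bot) : NSFP Γ A.wneg :=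
  impI (botE h)

theorem wnegE {Γ : Set (Fm L)} {A : Fm L} (h : NSFP Γ A.wneg) (hA : NSFP Γ A) : NSFP Γ bot :=
  of_wneg_wneg_bot (impE h hA)

theorem insert_right {Γ : Set (Fm L)} {A : Fm L} (B : Fm L) (h : NSFP Γ A) :
    NSFP (insert B Γ) A :=
  weaken (Set.subset_insert _ _) h

theorem head {Γ : Set (Fm L)} {A : Fm L} : NSFP (insert A Γ) A :=
  hyp (Set.mem_insert _ _)

theorem wneg_wneg_intro {Γ : Set (Fm L)} {A : Fm L} (h : NSFP Γ A) : NSFP Γ A.wneg.wneg :=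
  wnegI (wnegE head (h.insert_right _))

/-- The monadic bind: to prove a doubly weakly negated goal, the `⇀⇀` on a premise may be dropped.
-/
theorem wneg_wneg_bind {Γ : Set (Fm L)} {A C : Fm L} (h : NSFP Γ A.wneg.wneg)
    (hC : NSFP (insert A Γ) C.wneg.wneg) : NSFP Γ C.wneg.wneg := by
  refine wnegI (wnegE (h.insert_right _) (wnegI (wnegE (A := C.wneg) ?_ (head.insert_right _))))
  exact weaken (Set.insert_subset_insert (Set.subset_insert _ _)) hC

theorem wneg_wneg_map {Γ : Set (Fm L)} {A C : Fm L} (h : NSFP Γ A.wneg.wneg)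
    (hC : NSFP (insert A Γ) C) : NSFP Γ C.wneg.wneg :=
  h.wneg_wneg_bind hC.wneg_wneg_intro

/-- Every term is prevalently existent. -/
theorem wneg_wneg_exi (Γ : Set (Fm L)) (t : L.Term ℕ) : NSFP Γ (exi t).wneg.wneg := by
  have h := allE t (by simp [FreeFor]) (obj (L := L) (Γ := Γ) 0)
  -- `∀E` leaves a `⇀⇀` in front of `¬¬E(t)`, which is global negative and so stable; `dne` then
  -- yields `⇀⇀E(t)`.
  have h' : NSFP Γ (exi t).neg.neg :=
    stP (.st (.gn trivial)) (by simpa [subst, substTerm] using h)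
  exact impE (dne _) h'

/-- Under `⇀⇀` local and global introduction coincide, because the missing premise `E(t)` is
available under `⇀⇀`. -/
theorem wneg_wneg_exI {Γ : Set (Fm L)} {x : ℕ} {A : Fm L} (t : L.Term ℕ) (hf : A.FreeFor t x)
    (h : NSFP Γ (A.subst x t).wneg.wneg) : NSFP Γ (A.ex x).wneg.wneg := by
  by_cases hg : OccursOnlyGlobally x A
  · exact h.wneg_wneg_map (exGloI t hg hf head)
  · exact h.wneg_wneg_bind
      ((wneg_wneg_exi _ t).wneg_wneg_map (exLocI t hg hf (head.insert_right _) head))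

/-- In the local case the dischargeable hypothesis `E(x)` is an unneeded extra, added by weakening.
-/
theorem exE {Γ Δ : Set (Fm L)} {x y : ℕ} {A C : Fm L}
    (hf : A.FreeFor (FirstOrder.Language.Term.var x) y) (hx : x ∉ (A.ex y).freeVars)
    (hC : x ∉ C.freeVars) (hΔ : NotFreeIn x Δ) (h : NSFP Γ (A.ex y))
    (h' : NSFP (insert (A.subst y (FirstOrder.Language.Term.var x)) Δ) C) :
    NSFP (Γ ∪ Δ) C := by
  by_cases hg : OccursOnlyGlobally y A
  · exact exGloE hg hf hx hC hΔ h h'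
  · exact exLocE hg hf hx hC hΔ h
      (weaken (Set.insert_subset_insert (Set.subset_insert _ _)) h')

end NSFP

/-- Strict finitistic logic with prevalence proves the double weak negation of every classical
consequence. -/
theorem Classical.nsfp_wneg_wneg {Γ : Set (Fm L)} {A : Fm L} (h : Classical Γ A) :
    NSFP Γ A.wneg.wneg := by
  induction h with
  | hyp h => exact (NSFP.hyp h).wneg_wneg_intro
  | weaken hs _ ih => exact ih.weaken hs
  | topI => exact NSFP.topI.wneg_wneg_intro
  | botE _ _ ih => exact ih.of_wneg_wneg_bot.botE
  | raa _ _ ih => exact NSFP.wnegI ih.of_wneg_wneg_bot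
  | andI _ _ ih₁ ih₂ =>
    exact ih₁.wneg_wneg_bind
      ((ih₂.insert_right _).wneg_wneg_map (.andI (NSFP.head.insert_right _) .head))
  | andE₁ _ ih => exact ih.wneg_wneg_map NSFP.head.andE₁
  | andE₂ _ ih => exact ih.wneg_wneg_map NSFP.head.andE₂
  | orI₁ _ _ ih => exact ih.wneg_wneg_map NSFP.head.orI₁
  | orI₂ _ _ ih => exact ih.wneg_wneg_map NSFP.head.orI₂
  | orE _ _ _ ih ih₁ ih₂ =>
    exact ih.wneg_wneg_bind (.orE .head
      (ih₁.weaken (Set.insert_subset_insert (Set.subset_insert _ _)))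
      (ih₂.weaken (Set.insert_subset_insert (Set.subset_insert _ _))))
  | impI _ _ ih => exact (NSFP.impI ih).wneg_wneg_intro
  | impE _ _ ih₁ ih₂ =>
    exact ih₁.wneg_wneg_bind
      ((ih₂.insert_right _).wneg_wneg_bind (.impE (NSFP.head.insert_right _) .head))
  -- The rule takes `⇀⇀A` as its premise, so no double negation shift is needed.
  | allI hx _ ih => exact (NSFP.allI hx ih).wneg_wneg_intro
  | allE t hf _ ih => exact ih.wneg_wneg_bind (.allE t hf .head)
  | exI t hf _ ih => exact ih.wneg_wneg_exI t hf
  | @exE Γ Δ x y A C hf hx hC hΔ _ _ ih ih' =>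
    refine (ih.weaken Set.subset_union_left).wneg_wneg_bind ?_
    -- Keeping `∃yA` alone as the context of the major premise leaves the variable condition on `Δ`
    -- only; `Γ` may contain `x` free.
    refine NSFP.weaken ?_ (NSFP.exE (Γ := {A.ex y}) hf hx (by simpa [wneg, freeVars] using hC) hΔ
      (.hyp rfl) ih')
    rw [Set.singleton_union]
    exact Set.insert_subset_insert Set.subset_union_right

namespace Fm

/-- The classical reading of a formula: every term exists, and the primitive negation is the
weak one. -/
def classicize : Fm L → Fm L
  | top => top
  | bot => bot
  | atom P ts => atom P ts
  | exi _ => top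
  | and A B => and A.classicize B.classicize
  | or A B => or A.classicize B.classicize
  | imp A B => imp A.classicize B.classicize
  | neg A => A.classicize.wneg
  | all x A => all x A.classicize
  | ex x A => ex x A.classicize

theorem negEFree_classicize (A : Fm L) : A.classicize.NegEFree := by
  induction A <;> simp_all [classicize, NegEFree, NegFree, EFree, wneg]

theorem NegEFree.classicize_eq {A : Fm L} (h : A.NegEFree) : A.classicize = A := by
  induction A <;> simp_all [classicize, NegEFree, NegFree, EFree]

/-- Only an inclusion, since `E(t)` loses its variables; it suffices because the variable conditions
of the classical rules all demand non-occurrence. -/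
theorem freeVars_classicize_subset (A : Fm L) : A.classicize.freeVars ⊆ A.freeVars := by
  induction A with
  | and A B hA hB => exact Finset.union_subset_union hA hB
  | or A B hA hB => exact Finset.union_subset_union hA hB
  | imp A B hA hB => exact Finset.union_subset_union hA hB
  | neg A hA => simpa [classicize, wneg, freeVars] using hA
  | all x A hA => exact Finset.erase_subset_erase x hA
  | ex x A hA => exact Finset.erase_subset_erase x hA
  | _ => simp [classicize, freeVars]

theorem classicize_subst (x : ℕ) (t : L.Term ℕ) (A : Fm L) :
    (A.subst x t).classicize = A.classicize.subst x t := by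
  induction A with
  | all y A hA => by_cases h : y = x <;> simp [subst, classicize, h, hA]
  | ex y A hA => by_cases h : y = x <;> simp [subst, classicize, h, hA]
  | _ => simp_all [subst, classicize, wneg]

theorem FreeFor.classicize {t : L.Term ℕ} {x : ℕ} {A : Fm L} (h : A.FreeFor t x) :
    A.classicize.FreeFor t x := by
  induction A with
  | and A B hA hB => exact ⟨hA h.1, hB h.2⟩
  | or A B hA hB => exact ⟨hA h.1, hB h.2⟩
  | imp A B hA hB => exact ⟨hA h.1, hB h.2⟩
  | neg A hA => exact ⟨hA h, trivial⟩
  | all y A hA =>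
    exact h.imp (fun h' hx => h' (freeVars_classicize_subset (A.all y) hx)) (And.imp_right hA)
  | ex y A hA =>
    exact h.imp (fun h' hx => h' (freeVars_classicize_subset (A.ex y) hx)) (And.imp_right hA)
  | _ => trivial

end Fm

theorem NotFreeIn.image_classicize {x : ℕ} {Γ : Set (Fm L)} (h : NotFreeIn x Γ) :
    NotFreeIn x (classicize '' Γ) := by
  rintro _ ⟨B, hB, rfl⟩ hx
  exact h B hB (freeVars_classicize_subset B hx)

namespace Classical

theorem head {Γ : Set (Fm L)} {A : Fm L} : Classical (insert A Γ) A :=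
  hyp (Set.mem_insert _ _)

theorem insert_right {Γ : Set (Fm L)} {A : Fm L} (B : Fm L) (h : Classical Γ A) :
    Classical (insert B Γ) A :=
  weaken (Set.subset_insert _ _) h

theorem of_wneg_wneg {Γ : Set (Fm L)} {A : Fm L} (hA : A.NegEFree)
    (h : Classical Γ A.wneg.wneg) : Classical Γ A :=
  raa hA (impE (h.insert_right _) head)

theorem wneg_wneg_intro {Γ : Set (Fm L)} {A : Fm L} (hA : A.NegEFree) (h : Classical Γ A) :
    Classical Γ A.wneg.wneg :=
  impI ⟨⟨hA.1, trivial⟩, ⟨hA.2, trivial⟩⟩ (impE head (h.insert_right _))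

end Classical

/-- Strict finitistic logic with prevalence is sound for the classical reading of formulas. -/
theorem NSFP.classical {Γ : Set (Fm L)} {A : Fm L} (h : NSFP Γ A) :
    Classical (classicize '' Γ) A.classicize := by
  induction h with
  | hyp h => exact .hyp (Set.mem_image_of_mem _ h)
  | weaken hs _ ih => exact ih.weaken (Set.image_mono hs)
  | topI => exact .topI
  | botE _ ih => exact ih.botE (negEFree_classicize _)
  | andI _ _ ih₁ ih₂ => exact .andI ih₁ ih₂
  | andE₁ _ ih => exact .andE₁ ih
  | andE₂ _ ih => exact .andE₂ ih
  | orI₁ _ ih => exact .orI₁ (negEFree_classicize _) ih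
  | orI₂ _ ih => exact .orI₂ (negEFree_classicize _) ih
  | orE _ _ _ ih ih₁ ih₂ =>
    rw [Set.image_insert_eq] at ih₁ ih₂
    exact .orE ih ih₁ ih₂
  | str₁ i _ _ => exact .topI
  | str₂ i _ _ => exact .topI
  | stP _ _ ih => exact ih.of_wneg_wneg (negEFree_classicize _)
  | impI _ ih =>
    rw [Set.image_insert_eq] at ih
    exact .impI (negEFree_classicize _) (ih.of_wneg_wneg (negEFree_classicize _))
  | impE _ _ ih₁ ih₂ => exact (ih₁.impE ih₂).wneg_wneg_intro (negEFree_classicize _)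
  | negI _ ih => exact ih
  | negE _ _ ih₁ ih₂ => exact ih₁.impE ih₂
  | dne A =>
    exact .impI (negEFree_classicize A.neg.neg)
      (Classical.head.of_wneg_wneg (negEFree_classicize A))
  | @obj Γ x =>
    -- The variable may be free in `Γ`, so the generalization is done in the empty context.
    refine Classical.weaken (Set.empty_subset _) (.allI (fun _ h => h.elim) ?_)
    exact Classical.topI.wneg_wneg_intro ⟨trivial, trivial⟩
  | allI hx _ ih =>
    exact .allI hx.image_classicize (ih.of_wneg_wneg (negEFree_classicize _))
  | @allE Γ x A t hf _ ih =>
    have h := (Classical.allE t hf.classicize ih)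
    rw [← classicize_subst] at h
    exact h.wneg_wneg_intro (negEFree_classicize _)
  | exGloI t _ hf _ ih =>
    rw [classicize_subst] at ih
    exact .exI t hf.classicize ih
  | exLocI t _ hf _ _ ih _ =>
    rw [classicize_subst] at ih
    exact .exI t hf.classicize ih
  | @exGloE Γ Δ x y A C _ hf hx hC hΔ _ _ ih ih' =>
    rw [Set.image_insert_eq, classicize_subst] at ih'
    rw [Set.image_union]
    exact .exE hf.classicize (fun h => hx (freeVars_classicize_subset (A.ex y) h))
      (fun h => hC (freeVars_classicize_subset C h)) hΔ.image_classicize ih ih'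
  | @exLocE Γ Δ x y A C _ hf hx hC hΔ _ _ ih ih' =>
    rw [Set.image_insert_eq, Set.image_insert_eq, classicize_subst, Set.insert_comm] at ih'
    rw [Set.image_union]
    refine .exE hf.classicize (fun h => hx (freeVars_classicize_subset (A.ex y) h))
      (fun h => hC (freeVars_classicize_subset C h)) hΔ.image_classicize ih ?_
    -- The hypothesis `E(x)` has become `⊤`, which is cut away.
    exact .impE (.impI (negEFree_classicize top) ih') .topI

end SFQ

theorem mainTheorem7 (L : FirstOrder.Language.{u, v}) :
    (∀ A : SFQ.Fm L, A ∈ SFQ.CQC L ↔ A.wneg.wneg ∈ SFQ.SFQPNegEFree L) ∧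
    (∀ A : SFQ.Fm L, A.STP → A.EFree → A ∈ SFQ.CQC L → A ∈ SFQ.SFQPNegEFree L) := by
  refine ⟨fun A => ⟨?_, ?_⟩, ?_⟩
  · rintro ⟨hc, hA, h⟩
    exact ⟨by simpa [SFQ.Fm.Closed, SFQ.Fm.wneg, SFQ.Fm.freeVars] using hc,
      ⟨⟨⟨hA.1, trivial⟩, trivial⟩, ⟨⟨hA.2, trivial⟩, trivial⟩⟩, h.nsfp_wneg_wneg⟩
  · rintro ⟨hc, hA, h⟩
    have hA' : A.NegEFree := ⟨hA.1.1.1, hA.2.1.1⟩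
    refine ⟨by simpa [SFQ.Fm.Closed, SFQ.Fm.wneg, SFQ.Fm.freeVars] using hc, hA', ?_⟩
    have h' := h.classical
    rw [hA.classicize_eq, Set.image_empty] at h'
    exact h'.of_wneg_wneg hA'
  · rintro A hS - ⟨hc, hA, h⟩
    exact ⟨hc, hA, .stP hS h.nsfp_wneg_wneg⟩
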